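/- **Definitions.** A *form* over a category $\mathbb{C}$ is a functor $F\colon\mathbb{B}\to\mathbb{C}$ that is faithful and amnestic (an isomorphism sent by $F$ to an identity morphism is itself an identity morphism). A *cluster* in an object $X$ of $\mathbb C$ is an object $A$ of $\mathbb{B}$ with $F(A)=X$. For $f\colon X\to Y$ and clusters $A$ in $X$, $B$ in $Y$, write $B\ge_f A$ if $F$ sends some morphism $A\to B$ to $f$; the relation $\ge_{1_X}$ is a partial order $\ge$ on the clusters in $X$. An *operator* from a form $F\colon\mathbb A\to\mathbb C$ to a form $G\colon\mathbb B\to\mathbb C$ is a functor $\tau\colon\mathbb A\to\mathbb B$ with $G\tau=F$; forms are *isomorphic* if there is an operator between them that is an isomorphism of categories. A *subform* of $F\colon\mathbb B\to\mathbb C$ is the restriction of $F$ to a full subcategory of $\mathbb B$ (equivalently, it is given by an arbitrary choice of a class of clusters). A form $F$ is *orean* if: the clusters in each object $X$ form a bounded lattice (with top $\top_X$ and bottom $\bot_X$); $C\ge_{gf}A$ implies that $C\ge_g B\ge_f A$ for some $B$; and for all $f\colon X\to Y$, $S$ in $X$, $T$ in $Y$ there exist the direct image $f\cdot S=\min\{T'\mid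 T'\ge_f S\}$ and the inverse image $T\cdot f=\max\{S'\mid T\ge_f S'\}$. For an orean form put $\mathrm{Im} f=f\cdot\top_X$ and $\mathrm{Ker} f=\bot_Y\cdot f$; clusters of the form $\mathrm{Im} f$ are *conormal* and those of the form $\mathrm{Ker} f$ are *normal*. An orean form is conormal (normal) if all of its clusters are. An *embedding* of a conormal cluster $S$ in $X$ is a morphism $m\colon W\to X$ with $\mathrm{Im}\, m=S$ through which every $f'\colon W'\to X$ with $\mathrm{Im} f'\le S$ factors uniquely; dually, a *quotient* of a normal cluster $S$ in $X$ is a morphism $e\colon X\to Y$ with $\mathrm{Ker}\, e=S$ through which every $g'\colon X\to Y'$ with $\mathrm{Ker}\, g'\ge S$ factors uniquely. A *noetherian form* is an orean form such that 1. $(f\cdot S)\cdot f=S\vee\mathrm{Ker} f$ and $f\cdot(T\cdot f)=T\wedge\mathrm{Im} f$ for all $f\colon X\to Y$, $S$ in $X$, $T$ in $Y$; 2. every morphism $f$ factorizes as $f=me$ with $e$ a quotient of $\mathrm{Ker} f$ and $m$ an embedding of $\mathrm{Im} f$; 3. the join of two normal clusters is normal and the meet of two conormal clusters is conormal. An operator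 $\tau\colon F\to G$ between orean forms is *conormal* if $\tau(\mathrm{Im}^F f)=\mathrm{Im}^G f$ for all $f$, *normal* if $\tau(\mathrm{Ker}^F f)=\mathrm{Ker}^G f$ for all $f$, and *binormal* if both. A *join decomposition* of an orean form $F$ is a pair $(\kappa_s,\kappa_e)$ of idempotent operators $F\to F$ such that the subform $F_s$ of clusters fixed by $\kappa_s$ is a conormal orean form, the subform $F_e$ of clusters fixed by $\kappa_e$ is a normal orean form, and $S=\kappa_s(S)\vee\kappa_e(S)$ for every cluster $S$. It is *exact* if the operators $F\to F_s$ and $F\to F_e$ given by $\kappa_s$ and $\kappa_e$ are binormal, there exist a conormal operator $F_s\to F_e$ and a normal operator $F_e\to F_s$, the inclusion $F_s\to F$ is conormal and the inclusion $F_e\to F$ is normal. *(Exact) meet decompositions* are defined in the same way with $\wedge$ in place of $\vee$. A *bicategory* here is a triple $(\mathbb{C},\mathcal{E},\mathcal{M})$ of a category and two classes of its morphisms. A *noetherian form over* $(\mathbb{C},\mathcal{E},\mathcal{M})$ is a noetherian form $F$ over $\mathbb{C}$ such that $\mathcal{E}$ is the class of all quotients, and $\mathcal{M}$ the class of all embeddings,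 with respect to $F$. It is *optimal* if it is isomorphic to a subform of every noetherian form over the same bicategory. **Theorem.** Let $G$ be a noetherian form over a bicategory $(\mathbb{C},\mathcal{E},\mathcal{M})$. If $G$ has an exact join decomposition, then $G$ is optimal. Dually, if $G$ has an exact meet decomposition, then $G$ is optimal. -/

import Mathlib

open CategoryTheory

universe v₁ v₂ v₃ v u₁ u₂ u₃ u

noncomputable section

namespace Forms

/-! ### Forms and their clusters -/

section Basic

variable {𝔹 : Type u₁} [Category.{v₁} 𝔹] {C : Type u} [Category.{v} C]

/-- A form over `C`: a faithful amnestic functor into `C`. Amnestic means that an isomorphism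
sent to an identity morphism is itself an identity morphism. -/
class IsForm (F : 𝔹 ⥤ C) : Prop where
  faithful : F.Faithful
  amnestic : ∀ {A B : 𝔹} (i : A ≅ B) (h : F.obj A = F.obj B),
    F.map i.hom = eqToHom h → ∃ h' : A = B, i.hom = eqToHom h'

/-- The clusters in `X`: the objects which `F` maps to `X`. -/
@[ext]
structure Cluster (F : 𝔹 ⥤ C) (X : C) where
  obj : 𝔹
  obj_eq : F.obj obj = X

/-- `Rel F f A B` is the relation `B ≥_f A`: some morphism `A ⟶ B` is mapped to `f` by `F`. -/
def Rel (F : 𝔹 ⥤ C) {X Y : C} (f : X ⟶ Y) (A : Cluster F X) (B : Cluster F Y) : Prop :=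
  ∃ φ : A.obj ⟶ B.obj, F.IsHomLift f φ

/-- The clusters in `X` are ordered by the relation `≥_f` for `f` the identity of `X`. -/
instance (F : 𝔹 ⥤ C) [hF : IsForm F] (X : C) : PartialOrder (Cluster F X) where
  le A B := Rel F (𝟙 X) A B
  le_refl A := ⟨𝟙 _, IsHomLift.id A.obj_eq⟩
  le_trans A B D := by
    rintro ⟨φ, _⟩ ⟨ψ, _⟩
    exact ⟨φ ≫ ψ, inferInstance⟩
  le_antisymm A B := by
    rintro ⟨φ, hφ⟩ ⟨ψ, hψ⟩
    have := hF.faithful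
    have e₁ : F.map φ = eqToHom (A.obj_eq.trans B.obj_eq.symm) := by
      rw [IsHomLift.fac' F (𝟙 X) φ]; simp
    have e₂ : F.map ψ = eqToHom (B.obj_eq.trans A.obj_eq.symm) := by
      rw [IsHomLift.fac' F (𝟙 X) ψ]; simp
    obtain ⟨h, -⟩ := hF.amnestic
      ⟨φ, ψ, F.map_injective (by simp [e₁, e₂]), F.map_injective (by simp [e₁, e₂])⟩
      (A.obj_eq.trans B.obj_eq.symm) e₁
    exact Cluster.ext h

/-- Orean forms. -/
class IsOrean (F : 𝔹 ⥤ C) : Prop extends IsForm F where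
  /-- The clusters in each object form a bounded lattice. -/
  exists_bot : ∀ X : C, ∃ A : Cluster F X, IsBot A
  exists_top : ∀ X : C, ∃ A : Cluster F X, IsTop A
  exists_join : ∀ {X : C} (A B : Cluster F X), ∃ D : Cluster F X, IsLUB {A, B} D
  exists_meet : ∀ {X : C} (A B : Cluster F X), ∃ D : Cluster F X, IsGLB {A, B} D
  /-- The relations for `f` and `g` compose to the relation for `f ≫ g`. -/
  exists_between : ∀ {X Y Z : C} (f : X ⟶ Y) (g : Y ⟶ Z) (A : Cluster F X) (D : Cluster F Z),
    Rel F (f ≫ g) A D → ∃ B : Cluster F Y, Rel F f A B ∧ Rel F g B D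
  /-- Direct and inverse images exist. -/
  exists_dir : ∀ {X Y : C} (f : X ⟶ Y) (S : Cluster F X),
    ∃ T : Cluster F Y, IsLeast {T | Rel F f S T} T
  exists_inv : ∀ {X Y : C} (f : X ⟶ Y) (T : Cluster F Y),
    ∃ S : Cluster F X, IsGreatest {S | Rel F f S T} S

instance (F : 𝔹 ⥤ C) [hF : IsOrean F] (X : C) : Lattice (Cluster F X) where
  sup A B := (hF.exists_join A B).choose
  le_sup_left A B := (hF.exists_join A B).choose_spec.1 (by simp)
  le_sup_right A B := (hF.exists_join A B).choose_spec.1 (by simp)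
  sup_le A B _ h₁ h₂ := (hF.exists_join A B).choose_spec.2 (by
    rintro Z (rfl | rfl) <;> assumption)
  inf A B := (hF.exists_meet A B).choose
  inf_le_left A B := (hF.exists_meet A B).choose_spec.1 (by simp)
  inf_le_right A B := (hF.exists_meet A B).choose_spec.1 (by simp)
  le_inf A B D h₁ h₂ := (hF.exists_meet B D).choose_spec.2 (by
    rintro Z (rfl | rfl) <;> assumption)

instance (F : 𝔹 ⥤ C) [hF : IsOrean F] (X : C) : BoundedOrder (Cluster F X) where
  top := (hF.exists_top X).choose
  le_top := (hF.exists_top X).choose_spec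
  bot := (hF.exists_bot X).choose
  bot_le := (hF.exists_bot X).choose_spec

/-- The direct image `f · S`, the least `T` with `T ≥_f S`. -/
def dir (F : 𝔹 ⥤ C) [hF : IsOrean F] {X Y : C} (f : X ⟶ Y) (S : Cluster F X) : Cluster F Y :=
  (hF.exists_dir f S).choose

theorem dir_spec (F : 𝔹 ⥤ C) [hF : IsOrean F] {X Y : C} (f : X ⟶ Y) (S : Cluster F X) :
    IsLeast {T | Rel F f S T} (dir F f S) :=
  (hF.exists_dir f S).choose_spec

/-- The inverse image `T · f`, the greatest `S` with `T ≥_f S`. -/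
def inv (F : 𝔹 ⥤ C) [hF : IsOrean F] {X Y : C} (f : X ⟶ Y) (T : Cluster F Y) : Cluster F X :=
  (hF.exists_inv f T).choose

theorem inv_spec (F : 𝔹 ⥤ C) [hF : IsOrean F] {X Y : C} (f : X ⟶ Y) (T : Cluster F Y) :
    IsGreatest {S | Rel F f S T} (inv F f T) :=
  (hF.exists_inv f T).choose_spec

/-- The image of a morphism. -/
def im (F : 𝔹 ⥤ C) [IsOrean F] {X Y : C} (f : X ⟶ Y) : Cluster F Y := dir F f ⊤

/-- The kernel of a morphism. -/
def ker (F : 𝔹 ⥤ C) [IsOrean F] {X Y : C} (f : X ⟶ Y) : Cluster F X := inv F f ⊥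

/-- A cluster is conormal when it is the image of some morphism. -/
def IsConormal (F : 𝔹 ⥤ C) [IsOrean F] {X : C} (S : Cluster F X) : Prop :=
  ∃ (W : C) (f : W ⟶ X), S = im F f

/-- A cluster is normal when it is the kernel of some morphism. -/
def IsNormal (F : 𝔹 ⥤ C) [IsOrean F] {X : C} (S : Cluster F X) : Prop :=
  ∃ (Y : C) (g : X ⟶ Y), S = ker F g

/-- Conormal orean forms. -/
class IsConormalForm (F : 𝔹 ⥤ C) : Prop extends IsOrean F where
  conormal : ∀ {X : C} (S : Cluster F X), IsConormal F S

/-- Normal orean forms. -/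
class IsNormalForm (F : 𝔹 ⥤ C) : Prop extends IsOrean F where
  normal : ∀ {X : C} (S : Cluster F X), IsNormal F S

/-- `f` is an embedding of the conormal cluster `S`. -/
structure IsEmbedding (F : 𝔹 ⥤ C) [IsOrean F] {W X : C} (S : Cluster F X) (f : W ⟶ X) :
    Prop where
  im_eq : im F f = S
  lift : ∀ {W' : C} (f' : W' ⟶ X), im F f' ≤ S → ∃! g : W' ⟶ W, g ≫ f = f'

/-- `g` is a quotient of the normal cluster `S`. -/
structure IsQuotient (F : 𝔹 ⥤ C) [IsOrean F] {X Y : C} (S : Cluster F X) (g : X ⟶ Y) :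
    Prop where
  ker_eq : ker F g = S
  desc : ∀ {Y' : C} (g' : X ⟶ Y'), S ≤ ker F g' → ∃! h : Y ⟶ Y', g ≫ h = g'

/-- The class of `F`-embeddings. -/
def embeddings (F : 𝔹 ⥤ C) [IsOrean F] : MorphismProperty C :=
  fun _ X f => ∃ S : Cluster F X, IsEmbedding F S f

/-- The class of `F`-quotients. -/
def quotients (F : 𝔹 ⥤ C) [IsOrean F] : MorphismProperty C :=
  fun X _ g => ∃ S : Cluster F X, IsQuotient F S g

/-- Noetherian forms. -/
class IsNoetherian (F : 𝔹 ⥤ C) : Prop extends IsOrean F where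
  /-- `(f · S) · f = S ∨ Ker f` and `f · (T · f) = T ∧ Im f`. -/
  inv_dir : ∀ {X Y : C} (f : X ⟶ Y) (S : Cluster F X), inv F f (dir F f S) = S ⊔ ker F f
  dir_inv : ∀ {X Y : C} (f : X ⟶ Y) (T : Cluster F Y), dir F f (inv F f T) = T ⊓ im F f
  /-- Each `f` is a quotient of `Ker f` followed by an embedding of `Im f`. -/
  factor : ∀ {X Y : C} (f : X ⟶ Y), ∃ (Z : C) (e : X ⟶ Z) (m : Z ⟶ Y),
    IsQuotient F (ker F f) e ∧ IsEmbedding F (im F f) m ∧ e ≫ m = f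
  /-- Joins of normal clusters are normal, meets of conormal clusters are conormal. -/
  normal_sup : ∀ {X : C} (S T : Cluster F X), IsNormal F S → IsNormal F T → IsNormal F (S ⊔ T)
  conormal_inf : ∀ {X : C} (S T : Cluster F X),
    IsConormal F S → IsConormal F T → IsConormal F (S ⊓ T)

/-- `F` is a noetherian form over the bicategory `(C, E, M)`, where `E` and `M` are classes of
morphisms: `F` is noetherian, `E` is the class of `F`-quotients (the right morphisms) and `M` is
the class of `F`-embeddings (the left morphisms). -/
def IsNoetherianOver (F : 𝔹 ⥤ C) (E M : MorphismProperty C) : Prop :=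
  ∃ _ : IsNoetherian F, E = quotients F ∧ M = embeddings F

/-- The subform of `F` consisting of the clusters with the property `P`. -/
abbrev subform (F : 𝔹 ⥤ C) (P : ObjectProperty 𝔹) : P.FullSubcategory ⥤ C := P.ι ⋙ F

end Basic

/-! ### Operators -/

section Operators

variable {𝔸 : Type u₂} [Category.{v₂} 𝔸] {𝔹 : Type u₁} [Category.{v₁} 𝔹]
  {C : Type u} [Category.{v} C]

/-- An operator between forms over the same category: a functor between their domains which
commutes strictly with the forms. -/
structure Operator (F : 𝔸 ⥤ C) (G : 𝔹 ⥤ C) where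
  functor : 𝔸 ⥤ 𝔹
  comm : functor ⋙ G = F

/-- The action of an operator on clusters. -/
def Operator.app {F : 𝔸 ⥤ C} {G : 𝔹 ⥤ C} (τ : Operator F G) {X : C} (A : Cluster F X) :
    Cluster G X :=
  ⟨τ.functor.obj A.obj, (Functor.congr_obj τ.comm A.obj).trans A.obj_eq⟩

/-- Conormal operators preserve images. -/
def Operator.Conormal {F : 𝔸 ⥤ C} {G : 𝔹 ⥤ C} [IsOrean F] [IsOrean G] (τ : Operator F G) : Prop :=
  ∀ {X Y : C} (f : X ⟶ Y), τ.app (im F f) = im G f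

/-- Normal operators preserve kernels. -/
def Operator.Normal {F : 𝔸 ⥤ C} {G : 𝔹 ⥤ C} [IsOrean F] [IsOrean G] (τ : Operator F G) : Prop :=
  ∀ {X Y : C} (f : X ⟶ Y), τ.app (ker F f) = ker G f

/-- Binormal operators. -/
def Operator.Binormal {F : 𝔸 ⥤ C} {G : 𝔹 ⥤ C} [IsOrean F] [IsOrean G] (τ : Operator F G) : Prop :=
  τ.Conormal ∧ τ.Normal

/-- Isomorphism of forms: an isomorphism of categories which is an operator. -/
def IsIsomorphic (F : 𝔸 ⥤ C) (G : 𝔹 ⥤ C) : Prop :=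
  ∃ (φ : Operator F G) (ψ : 𝔹 ⥤ 𝔸), φ.functor ⋙ ψ = 𝟭 𝔸 ∧ ψ ⋙ φ.functor = 𝟭 𝔹

/-- `G` is isomorphic to some subform of `F`. -/
def IsIsomorphicToSubform (G : 𝔸 ⥤ C) (F : 𝔹 ⥤ C) : Prop :=
  ∃ P : ObjectProperty 𝔹, IsIsomorphic G (subform F P)

/-- The inclusion of a subform. -/
def incl (F : 𝔹 ⥤ C) (P : ObjectProperty 𝔹) : Operator (subform F P) F where
  functor := P.ι
  comm := rfl

/-- Idempotent operators. -/
def Operator.Idempotent {F : 𝔹 ⥤ C} (κ : Operator F F) : Prop :=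
  κ.functor ⋙ κ.functor = κ.functor

/-- The clusters closed relative to an operator `κ`: those which `κ` fixes. -/
def Operator.closed {F : 𝔹 ⥤ C} (κ : Operator F F) : ObjectProperty 𝔹 :=
  fun A => κ.functor.obj A = A

/-- The subform of closed clusters. -/
abbrev Operator.closedForm {F : 𝔹 ⥤ C} (κ : Operator F F) : κ.closed.FullSubcategory ⥤ C :=
  subform F κ.closed

/-- An idempotent operator, regarded as an operator to its subform of closed clusters. -/
def Operator.proj {F : 𝔹 ⥤ C} (κ : Operator F F) (hκ : κ.Idempotent) :
    Operator F κ.closedForm where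
  functor := κ.closed.lift κ.functor (fun A => Functor.congr_obj hκ A)
  comm := κ.comm

/-- Semiexact pairs. -/
def IsSemiexactPair (Fs : 𝔸 ⥤ C) (Fe : 𝔹 ⥤ C) : Prop :=
  ∃ (_ : IsConormalForm Fs) (_ : IsNormalForm Fe),
    (∃ α : Operator Fs Fe, α.Conormal) ∧ (∃ β : Operator Fe Fs, β.Normal)

end Operators

/-! ### Decompositions -/

section Decompositions

variable {𝔹 : Type u₁} [Category.{v₁} 𝔹] {C : Type u} [Category.{v} C]

/-- The binary terms of the theory of bounded lattices that can occur as decomposing terms. -/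
inductive LatticeTerm
  | top | bot | left | right | join | meet

/-- The interpretation of a term in a bounded lattice. -/
def LatticeTerm.eval {L : Type u₁} [Lattice L] [BoundedOrder L] : LatticeTerm → L → L → L
  | .top, _, _ => ⊤
  | .bot, _, _ => ⊥
  | .left, x, _ => x
  | .right, _, y => y
  | .join, x, y => x ⊔ y
  | .meet, x, y => x ⊓ y

/-- `(κs, κe)` is a decomposition of the orean form `F` with decomposing term `t`. -/
structure IsDecomposition (t : LatticeTerm) (F : 𝔹 ⥤ C) [IsOrean F] (κs κe : Operator F F) :
    Prop where
  idem_s : κs.Idempotent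
  idem_e : κe.Idempotent
  conormal_s : IsConormalForm κs.closedForm
  normal_e : IsNormalForm κe.closedForm
  eq_eval : ∀ {X : C} (S : Cluster F X), S = t.eval (κs.app S) (κe.app S)

/-- Exact decompositions: semiexact ones (the decomposition projections are binormal and the two
subforms form a semiexact pair) for which the subform inclusions are respectively conormal and
normal. -/
def IsExactDecomposition (t : LatticeTerm) (F : 𝔹 ⥤ C) [IsOrean F] (κs κe : Operator F F) : Prop :=
  ∃ h : IsDecomposition t F κs κe,
    have := h.conormal_s
    have := h.normal_e
    (κs.proj h.idem_s).Binormal ∧ (κe.proj h.idem_e).Binormal ∧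
    IsSemiexactPair κs.closedForm κe.closedForm ∧
    (incl F κs.closed).Conormal ∧ (incl F κe.closed).Normal

/-- `F` is an orean form which has an exact join decomposition. -/
def HasExactJoinDecomposition (F : 𝔹 ⥤ C) : Prop :=
  ∃ (_ : IsOrean F) (κs κe : Operator F F), IsExactDecomposition .join F κs κe

/-- `F` is an orean form which has an exact meet decomposition. -/
def HasExactMeetDecomposition (F : 𝔹 ⥤ C) : Prop :=
  ∃ (_ : IsOrean F) (κs κe : Operator F F), IsExactDecomposition .meet F κs κe

end Decompositions

/-- A noetherian form over the bicategory `(C, E, M)` is optimal when it is isomorphic to a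
subform of any noetherian form over `(C, E, M)`. -/
def IsOptimal {𝔸 : Type u₂} [Category.{v₂} 𝔸] {C : Type u} [Category.{v} C]
    (G : 𝔸 ⥤ C) (E M : MorphismProperty C) : Prop :=
  IsNoetherianOver G E M ∧
    ∀ (𝔹 : Type u₃) [Category.{v₃} 𝔹] (F : 𝔹 ⥤ C),
      IsNoetherianOver F E M → IsIsomorphicToSubform G F

end Forms

end

noncomputable section

namespace Forms

/-! ### Calculus of direct and inverse images -/

section Calculus

variable {𝔹 : Type u₁} [Category.{v₁} 𝔹] {C : Type u} [Category.{v} C] {F : 𝔹 ⥤ C}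

/-! Inequalities between images, and inequalities between kernels, depend only on the bicategory:
`Im f ≤ Im g` says that `f` factors through the embedding part of `g`, and dually
(`im_le_im_of_quotients_le`, `ker_le_ker_of_embeddings_le`). An exact join decomposition of `G`
writes each cluster as `Im m ∨ Ker e`, with `Im m = κs S` and `Ker e = κe S`. Sending it to `Im m ∨
Ker e` computed in `F` gives the required subform once this map preserves and reflects all relations
(`isIsomorphicToSubform_of_rel_iff`).

Preservation: `κs` and `κe` split a relation in `G` into one between images and one between kernels.
Reflection: since `Im m ∨ Ker e` is the inverse image of `Im (m ≫ e)` along `e`, what remains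
besides an inequality of images is a relation from a kernel to an image, and this reduces to `Ker d
≤ Im l` (`rel_ker_im_of_le`). Exactness makes `κe (Im l)` a kernel `Ker b` below `Im l`. In `F`,
`Ker d ≤ Im l` forces `Ker d ≤ Ker b`, an inequality of kernels, which passes to `G`. For meets, the
dual argument uses the image `κs (Ker d)` above `Ker d`. -/

theorem Rel.comp {X Y Z : C} {f : X ⟶ Y} {g : Y ⟶ Z} {A : Cluster F X} {B : Cluster F Y}
    {D : Cluster F Z} (h₁ : Rel F f A B) (h₂ : Rel F g B D) : Rel F (f ≫ g) A D := by
  obtain ⟨φ, _⟩ := h₁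
  obtain ⟨ψ, _⟩ := h₂
  exact ⟨φ ≫ ψ, inferInstance⟩

theorem Rel.le_right [IsForm F] {X Y : C} {f : X ⟶ Y} {A : Cluster F X} {B B' : Cluster F Y}
    (h : Rel F f A B) (hB : B ≤ B') : Rel F f A B' := by
  simpa using h.comp (g := 𝟙 Y) hB

theorem Rel.le_left [IsForm F] {X Y : C} {f : X ⟶ Y} {A A' : Cluster F X} {B : Cluster F Y}
    (h : Rel F f A B) (hA : A' ≤ A) : Rel F f A' B := by
  simpa using Rel.comp (f := 𝟙 X) hA h

variable [IsOrean F] {X Y Z : C}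

theorem rel_iff_dir_le {f : X ⟶ Y} {S : Cluster F X} {T : Cluster F Y} :
    Rel F f S T ↔ dir F f S ≤ T :=
  ⟨fun h => (dir_spec F f S).2 h, fun h => Rel.le_right (dir_spec F f S).1 h⟩

theorem rel_iff_le_inv {f : X ⟶ Y} {S : Cluster F X} {T : Cluster F Y} :
    Rel F f S T ↔ S ≤ inv F f T :=
  ⟨fun h => (inv_spec F f T).2 h, fun h => Rel.le_left (inv_spec F f T).1 h⟩

theorem dir_le_iff_le_inv {f : X ⟶ Y} {S : Cluster F X} {T : Cluster F Y} :
    dir F f S ≤ T ↔ S ≤ inv F f T :=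
  rel_iff_dir_le.symm.trans rel_iff_le_inv

theorem galoisConnection_dir_inv (f : X ⟶ Y) : GaloisConnection (dir F f) (inv F f) :=
  fun _ _ => dir_le_iff_le_inv

theorem rel_comp_iff_dir {f : X ⟶ Y} {g : Y ⟶ Z} {S : Cluster F X} {T : Cluster F Z} :
    Rel F (f ≫ g) S T ↔ Rel F g (dir F f S) T := by
  constructor
  · intro h
    obtain ⟨B, h₁, h₂⟩ := IsOrean.exists_between f g S T h
    exact h₂.le_left (rel_iff_dir_le.1 h₁)
  · exact fun h => Rel.comp (dir_spec F f S).1 h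

theorem rel_comp_iff_inv {f : X ⟶ Y} {g : Y ⟶ Z} {S : Cluster F X} {T : Cluster F Z} :
    Rel F (f ≫ g) S T ↔ Rel F f S (inv F g T) := by
  rw [rel_comp_iff_dir, rel_iff_le_inv, rel_iff_dir_le]

theorem dir_comp (f : X ⟶ Y) (g : Y ⟶ Z) (S : Cluster F X) :
    dir F (f ≫ g) S = dir F g (dir F f S) :=
  eq_of_forall_ge_iff fun T => by rw [← rel_iff_dir_le, ← rel_iff_dir_le, rel_comp_iff_dir]

theorem inv_comp (f : X ⟶ Y) (g : Y ⟶ Z) (T : Cluster F Z) :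
    inv F (f ≫ g) T = inv F f (inv F g T) :=
  eq_of_forall_le_iff fun S => by rw [← rel_iff_le_inv, ← rel_iff_le_inv, rel_comp_iff_inv]

theorem dir_id (S : Cluster F X) : dir F (𝟙 X) S = S :=
  eq_of_forall_ge_iff fun _ => rel_iff_dir_le.symm

theorem inv_id (S : Cluster F X) : inv F (𝟙 X) S = S :=
  eq_of_forall_le_iff fun _ => rel_iff_le_inv.symm

theorem im_comp (f : X ⟶ Y) (g : Y ⟶ Z) : im F (f ≫ g) = dir F g (im F f) :=
  dir_comp f g ⊤

theorem ker_comp (f : X ⟶ Y) (g : Y ⟶ Z) : ker F (f ≫ g) = inv F f (ker F g) :=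
  inv_comp f g ⊥

theorem im_comp_le (f : X ⟶ Y) (g : Y ⟶ Z) : im F (f ≫ g) ≤ im F g := by
  rw [im_comp]
  exact (galoisConnection_dir_inv g).monotone_l le_top

theorem ker_le_comp (f : X ⟶ Y) (g : Y ⟶ Z) : ker F f ≤ ker F (f ≫ g) := by
  rw [ker_comp]
  exact (galoisConnection_dir_inv f).monotone_u bot_le

theorem im_eq_top_of_rightInverse {f : X ⟶ Y} {g : Y ⟶ X} (h : g ≫ f = 𝟙 Y) :
    im F f = ⊤ := by
  refine top_le_iff.1 ?_
  calc (⊤ : Cluster F Y) = im F (g ≫ f) := by rw [h]; exact (dir_id _).symm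
    _ ≤ im F f := im_comp_le g f

theorem ker_eq_bot_of_leftInverse {f : X ⟶ Y} {g : Y ⟶ X} (h : f ≫ g = 𝟙 X) :
    ker F f = ⊥ := by
  refine le_bot_iff.1 ?_
  calc ker F f ≤ ker F (f ≫ g) := ker_le_comp f g
    _ = ⊥ := by rw [h]; exact inv_id _

end Calculus

/-! ### Noetherian forms -/

section Noetherian

variable {𝔹 : Type u₁} [Category.{v₁} 𝔹] {C : Type u} [Category.{v} C] {F : 𝔹 ⥤ C}
  [IsNoetherian F] {X Y Z : C}

theorem im_eq_top_of_quotients {e : X ⟶ Y} (he : quotients F e) : im F e = ⊤ := by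
  obtain ⟨S, he⟩ := he
  obtain ⟨Z, e', m, he', hm, fac⟩ := IsNoetherian.factor (F := F) e
  obtain ⟨k, hk, -⟩ := he.desc e' (by rw [he'.ker_eq, he.ker_eq])
  rw [← hm.im_eq]
  -- Both `k ≫ m` and the identity are descents of `e` along itself, so they agree and `m` is split
  -- epi.
  refine im_eq_top_of_rightInverse (g := k) ((he.desc e he.ker_eq.ge).unique ?_ ?_)
  · rw [← Category.assoc, hk, fac]
  · exact Category.comp_id e

theorem ker_eq_bot_of_embeddings {m : X ⟶ Y} (hm : embeddings F m) : ker F m = ⊥ := by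
  obtain ⟨S, hm⟩ := hm
  obtain ⟨Z, e, m', he, hm', fac⟩ := IsNoetherian.factor (F := F) m
  obtain ⟨k, hk, -⟩ := hm.lift m' (by rw [hm'.im_eq, hm.im_eq])
  rw [← he.ker_eq]
  refine ker_eq_bot_of_leftInverse (g := k) ((hm.lift m hm.im_eq.le).unique ?_ ?_)
  · rw [Category.assoc, hk, fac]
  · exact Category.id_comp m

theorem dir_ker_of_quotients {e : X ⟶ Y} (he : quotients F e) (d : Y ⟶ Z) :
    dir F e (ker F (e ≫ d)) = ker F d := by
  rw [ker_comp, IsNoetherian.dir_inv, im_eq_top_of_quotients he, inf_top_eq]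

theorem inv_im_of_embeddings {m : Y ⟶ Z} (hm : embeddings F m) (l : X ⟶ Y) :
    inv F m (im F (l ≫ m)) = im F l := by
  rw [im_comp, IsNoetherian.inv_dir, ker_eq_bot_of_embeddings hm, sup_bot_eq]

/-- The direct image of a normal cluster along a quotient is normal. -/
theorem exists_ker_eq_dir {e : X ⟶ Y} (he : IsQuotient F (ker F e) e) (a : X ⟶ Z) :
    ∃ (Z' : C) (d : Y ⟶ Z'), ker F d = dir F e (ker F a) := by
  -- Joining with `Ker e` leaves the direct image along `e` unchanged, and makes the witnessing
  -- morphism `c` descend along `e`.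
  obtain ⟨Z', c, hc⟩ := IsNoetherian.normal_sup (ker F a) (ker F e) ⟨_, a, rfl⟩ ⟨_, e, rfl⟩
  obtain ⟨d, rfl, -⟩ := he.desc c (hc ▸ le_sup_right)
  refine ⟨Z', d, ?_⟩
  rw [← dir_ker_of_quotients ⟨_, he⟩ d, ← hc, ← IsNoetherian.inv_dir]
  exact (galoisConnection_dir_inv e).l_u_l_eq_l _

/-- The inverse image of a conormal cluster along an embedding is conormal. -/
theorem exists_im_eq_inv {n : Y ⟶ Z} (hn : IsEmbedding F (im F n) n) (m : X ⟶ Z) :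
    ∃ (W : C) (l : W ⟶ Y), im F l = inv F n (im F m) := by
  obtain ⟨W, k, hk⟩ := IsNoetherian.conormal_inf (im F m) (im F n) ⟨_, m, rfl⟩ ⟨_, n, rfl⟩
  obtain ⟨l, rfl, -⟩ := hn.lift k (hk ▸ inf_le_right)
  refine ⟨W, l, ?_⟩
  rw [← inv_im_of_embeddings ⟨_, hn⟩ l, ← hk, ← IsNoetherian.dir_inv]
  exact (galoisConnection_dir_inv n).u_l_u_eq_u _

/-- Absorbs the kernel into an inverse image, so that a relation into `Im m ∨ Ker e` becomes a
relation into a single image. -/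
theorem im_sup_ker (m : X ⟶ Y) (e : Y ⟶ Z) : im F m ⊔ ker F e = inv F e (im F (m ≫ e)) := by
  rw [im_comp, IsNoetherian.inv_dir]

theorem im_inf_ker (m : X ⟶ Y) (e : Y ⟶ Z) : im F m ⊓ ker F e = dir F m (ker F (m ≫ e)) := by
  rw [ker_comp, IsNoetherian.dir_inv, inf_comm]

end Noetherian

/-! ### Comparing noetherian forms over the same bicategory -/

section Transfer

variable {𝔹 : Type u₁} [Category.{v₁} 𝔹] {𝔸 : Type u₂} [Category.{v₂} 𝔸]
  {C : Type u} [Category.{v} C] {F : 𝔹 ⥤ C} {G : 𝔸 ⥤ C} [IsNoetherian F] [IsNoetherian G]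
  {X Y Z W : C}

/-- The inequality in `F` yields a factorization in `C`, which is independent of the form. The
quotient part of `g` still has image `⊤` in `G`, so `g` and its embedding part have the same image
there. -/
theorem im_le_im_of_quotients_le (hE : quotients F ≤ quotients G) {f : X ⟶ Z} {g : Y ⟶ Z}
    (h : im F f ≤ im F g) : im G f ≤ im G g := by
  obtain ⟨V, e, m, he, hm, fac⟩ := IsNoetherian.factor (F := F) g
  obtain ⟨k, rfl, -⟩ := hm.lift f h
  calc im G (k ≫ m) ≤ im G m := im_comp_le k m
    _ = im G g := by rw [← fac, im_comp, im_eq_top_of_quotients (hE _ ⟨_, he⟩)]; rfl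

theorem ker_le_ker_of_embeddings_le (hM : embeddings F ≤ embeddings G) {f : X ⟶ Y} {g : X ⟶ Z}
    (h : ker F f ≤ ker F g) : ker G f ≤ ker G g := by
  obtain ⟨V, e, m, he, hm, fac⟩ := IsNoetherian.factor (F := F) f
  obtain ⟨k, rfl, -⟩ := he.desc g h
  calc ker G f = ker G e := by
        rw [← fac, ker_comp, ker_eq_bot_of_embeddings (hM _ ⟨_, hm⟩)]; rfl
    _ ≤ ker G (e ≫ k) := ker_le_comp e k

/-- If `Ker d ≤ Im l` in `F` always implies the same in `G`, then `Im m ≥_g Ker a` in `F` implies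
the same in `G`. -/
theorem rel_ker_im_of_le (hE : quotients F ≤ quotients G) (hM : embeddings F ≤ embeddings G)
    (H : ∀ {U V T : C} (d : V ⟶ T) (l : U ⟶ V), ker F d ≤ im F l → ker G d ≤ im G l)
    {a : X ⟶ Z} {g : X ⟶ Y} {m : W ⟶ Y} (h : Rel F g (ker F a) (im F m)) :
    Rel G g (ker G a) (im G m) := by
  obtain ⟨V, e, n, he, hn, fac⟩ := IsNoetherian.factor (F := F) g
  rw [← he.ker_eq] at he
  rw [← hn.im_eq] at hn
  subst fac
  -- Pushing `Ker a` forward along `e` and pulling `Im m` back along `n` turns the relation into an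
  -- inequality at the middle object `V`.
  obtain ⟨T, d, hd⟩ := exists_ker_eq_dir he a
  obtain ⟨U, l, hl⟩ := exists_im_eq_inv hn m
  rw [rel_comp_iff_dir, ← hd, rel_iff_le_inv, ← hl] at h
  have had : Rel G e (ker G a) (ker G d) := by
    rw [rel_iff_le_inv, ← ker_comp]
    refine ker_le_ker_of_embeddings_le hM ?_
    rw [ker_comp, hd]
    exact (galoisConnection_dir_inv e).le_u_l _
  have hlm : Rel G n (im G l) (im G m) := by
    rw [rel_iff_dir_le, ← im_comp]
    refine im_le_im_of_quotients_le hE ?_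
    rw [im_comp, hl]
    exact (galoisConnection_dir_inv n).l_u_le _
  exact had.comp (hlm.le_left (H d l h))

/-- `Ker d ≤ Im l` passes from `F` to `G` if, in `G`, each `Im m` has a normal cluster below it which
contains the direct image under `m` of the largest normal cluster. -/
theorem ker_le_im_of_exists_ker_le_im (hM : embeddings F = embeddings G)
    (H : ∀ {W X : C} (m : W ⟶ X), ∃ (Y T : C) (b : X ⟶ Y) (t : W ⟶ T), ker G b ≤ im G m ∧
      (∀ {V : C} (c : W ⟶ V), ker G c ≤ ker G t) ∧ ker G t ≤ ker G (m ≫ b))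
    {d : X ⟶ Y} {l : W ⟶ X} (h : ker F d ≤ im F l) : ker G d ≤ im G l := by
  obtain ⟨V, T, b, t, hb, ht, htb⟩ := H l
  refine le_trans (ker_le_ker_of_embeddings_le hM.le ?_) hb
  have ht' := ker_le_ker_of_embeddings_le hM.ge (ht (l ≫ d))
  have htb' := ker_le_ker_of_embeddings_le hM.ge htb
  -- In `F`, `Ker d` is now the direct image along `l` of `Ker (l ≫ d)`, so only kernels on `W`
  -- remain to be compared.
  rw [← inf_eq_left, inf_comm, im_inf_ker] at h
  rw [← h, dir_le_iff_le_inv, ← ker_comp]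
  exact ht'.trans htb'

/-- `Ker d ≤ Im l` passes from `F` to `G` if, in `G`, each `Ker d` has a conormal cluster above it
which is contained in the inverse image under `d` of the smallest conormal cluster. -/
theorem ker_le_im_of_exists_ker_le_im' (hE : quotients F = quotients G)
    (H : ∀ {X Y : C} (d : X ⟶ Y), ∃ (W T : C) (n : W ⟶ X) (z : T ⟶ Y), ker G d ≤ im G n ∧
      (∀ {V : C} (c : V ⟶ Y), im G z ≤ im G c) ∧ im G (n ≫ d) ≤ im G z)
    {d : X ⟶ Y} {l : W ⟶ X} (h : ker F d ≤ im F l) : ker G d ≤ im G l := by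
  obtain ⟨V, T, n, z, hn, hz, hnz⟩ := H d
  refine le_trans hn (im_le_im_of_quotients_le hE.le ?_)
  have hz' := im_le_im_of_quotients_le hE.ge (hz (l ≫ d))
  have hnz' := im_le_im_of_quotients_le hE.ge hnz
  -- Dually, `Im l` is the inverse image along `d` of `Im (l ≫ d)`, which leaves a comparison of
  -- images in `Y`.
  rw [← sup_eq_left, im_sup_ker] at h
  rw [← h, ← dir_le_iff_le_inv, ← im_comp]
  exact hnz'.trans hz'

end Transfer

/-! ### Isomorphism with a subform -/

section Subform

variable {𝔹 : Type u₁} [Category.{v₁} 𝔹] {𝔸 : Type u₂} [Category.{v₂} 𝔸]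
  {C : Type u} [Category.{v} C] {F : 𝔹 ⥤ C} {G : 𝔸 ⥤ C}

theorem isIsomorphicToSubform_of_operator (τ : Operator G F) [τ.functor.Full]
    [τ.functor.Faithful] (hτ : Function.Injective τ.functor.obj) :
    IsIsomorphicToSubform G F := by
  obtain ⟨T, rfl⟩ := τ
  dsimp only at *
  let P : ObjectProperty 𝔹 := fun B => ∃ A, T.obj A = B
  let ψ : P.FullSubcategory ⥤ 𝔸 :=
    { obj := fun B => B.2.choose
      map := fun {B B'} φ => T.preimage
        (eqToHom B.2.choose_spec ≫ φ.hom ≫ eqToHom B'.2.choose_spec.symm)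
      map_id := fun B => T.map_injective (by simp)
      map_comp := fun φ φ' => T.map_injective (by simp) }
  have hψ : ∀ B : P.FullSubcategory, T.obj (ψ.obj B) = B.obj := fun B => B.2.choose_spec
  refine ⟨P, ⟨P.lift T fun A => ⟨A, rfl⟩, rfl⟩, ψ, ?_, ?_⟩
  · refine CategoryTheory.Functor.ext (fun A => hτ (hψ _)) fun A B f => T.map_injective ?_
    simp [ψ, eqToHom_map]
  · refine CategoryTheory.Functor.ext (fun B => ObjectProperty.FullSubcategory.ext (hψ B))
      fun A B f => P.ι.map_injective ?_
    simp [ψ]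

/-- Faithfulness makes the lifts of morphisms unique, hence functorial. Reflection of relations
gives fullness and, with antisymmetry, injectivity on objects. -/
theorem isIsomorphicToSubform_of_rel_iff [IsForm F] [IsForm G]
    (θ : ∀ {X : C}, Cluster G X → Cluster F X)
    (hθ : ∀ {X Y : C} (f : X ⟶ Y) (A : Cluster G X) (B : Cluster G Y),
      Rel F f (θ A) (θ B) ↔ Rel G f A B) :
    IsIsomorphicToSubform G F := by
  have hF : F.Faithful := IsForm.faithful
  have hG : G.Faithful := IsForm.faithful
  let o (A : 𝔸) : Cluster F (G.obj A) := θ ⟨A, rfl⟩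
  have ho {X : C} (A : Cluster G X) : (o A.obj).obj = (θ A).obj := by
    obtain ⟨A, rfl⟩ := A
    rfl
  have key {A B : 𝔸} (φ : A ⟶ B) : ∃ ψ : (o A).obj ⟶ (o B).obj,
      F.map ψ = eqToHom (o A).obj_eq ≫ G.map φ ≫ eqToHom (o B).obj_eq.symm := by
    obtain ⟨ψ, hψ⟩ := (hθ (G.map φ) ⟨A, rfl⟩ ⟨B, rfl⟩).2 ⟨φ, inferInstance⟩
    exact ⟨ψ, IsHomLift.fac' F (G.map φ) ψ⟩
  choose m hm using @key
  let T : 𝔸 ⥤ 𝔹 :=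
    { obj := fun A => (o A).obj
      map := fun φ => m φ
      map_id := fun A => F.map_injective (by simp [hm])
      map_comp := fun φ φ' => F.map_injective (by simp [hm]) }
  let τ : Operator G F := ⟨T, CategoryTheory.Functor.ext (fun A => (o A).obj_eq) fun A B φ => hm φ⟩
  have : τ.functor.Faithful := ⟨fun {A B} φ φ' h => G.map_injective (by
    have h' : m φ = m φ' := h
    have h₁ := hm φ
    rw [h', hm φ', cancel_epi, cancel_mono] at h₁
    exact h₁.symm)⟩
  have : τ.functor.Full := ⟨fun {A B} χ => by
    change (o A).obj ⟶ (o B).obj at χ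
    obtain ⟨φ, hφ⟩ := (hθ (eqToHom (o A).obj_eq.symm ≫ F.map χ ≫ eqToHom (o B).obj_eq)
      ⟨A, rfl⟩ ⟨B, rfl⟩).1 ⟨χ, IsHomLift.of_fac' _ _ _ (o A).obj_eq (o B).obj_eq (by simp)⟩
    change A ⟶ B at φ
    have hφ' : G.map φ = eqToHom (o A).obj_eq.symm ≫ F.map χ ≫ eqToHom (o B).obj_eq := by
      have := @IsHomLift.fac' _ _ _ _ G _ _ _ _ _ φ hφ
      rw [this]
      simp
    refine ⟨φ, F.map_injective ((hm φ).trans ?_)⟩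
    rw [hφ']
    simp⟩
  refine isIsomorphicToSubform_of_operator τ fun A B h => ?_
  replace h : (o A).obj = (o B).obj := h
  have hX : G.obj B = G.obj A := by rw [← (o A).obj_eq, ← (o B).obj_eq, h]
  have hAB : θ (⟨A, rfl⟩ : Cluster G (G.obj A)) = θ ⟨B, hX⟩ := Cluster.ext (h.trans (ho ⟨B, hX⟩))
  have : (⟨A, rfl⟩ : Cluster G (G.obj A)) = ⟨B, hX⟩ :=
    le_antisymm ((hθ (𝟙 _) _ _).1 (le_of_eq hAB)) ((hθ (𝟙 _) _ _).1 (le_of_eq hAB.symm))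
  exact congrArg Cluster.obj this

end Subform

/-! ### Decompositions -/

section Decompositions

variable {𝔹 : Type u₁} [Category.{v₁} 𝔹] {𝔸 : Type u₂} [Category.{v₂} 𝔸]
  {C : Type u} [Category.{v} C]

theorem Operator.rel_app {F : 𝔸 ⥤ C} {G : 𝔹 ⥤ C} (τ : Operator F G) {X Y : C} {f : X ⟶ Y}
    {A : Cluster F X} {B : Cluster F Y} (h : Rel F f A B) : Rel G f (τ.app A) (τ.app B) := by
  obtain ⟨T, rfl⟩ := τ
  obtain ⟨φ, hφ⟩ := h
  exact ⟨T.map φ, IsHomLift.of_fac' _ _ _ A.obj_eq B.obj_eq (IsHomLift.fac' (T ⋙ G) f φ)⟩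

theorem Operator.app_le_app {F : 𝔸 ⥤ C} {G : 𝔹 ⥤ C} [IsForm F] [IsForm G] (τ : Operator F G)
    {X : C} {A B : Cluster F X} (h : A ≤ B) : τ.app A ≤ τ.app B :=
  τ.rel_app h

variable {t : LatticeTerm} {G : 𝔸 ⥤ C} [IsOrean G] {κs κe : Operator G G}

theorem IsExactDecomposition.exists_eq_im (h : IsExactDecomposition t G κs κe) {X : C}
    (S : Cluster G X) : ∃ (W : C) (m : W ⟶ X), κs.app S = im G m := by
  obtain ⟨h, h'⟩ := h
  have := h.conormal_s
  have := h.normal_e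
  obtain ⟨-, -, -, hs, -⟩ := h'
  obtain ⟨W, m, hm⟩ := IsConormalForm.conormal ((κs.proj h.idem_s).app S)
  exact ⟨W, m, (congrArg (incl G κs.closed).app hm).trans (hs m)⟩

theorem IsExactDecomposition.exists_eq_ker (h : IsExactDecomposition t G κs κe) {X : C}
    (S : Cluster G X) : ∃ (Y : C) (e : X ⟶ Y), κe.app S = ker G e := by
  obtain ⟨h, h'⟩ := h
  have := h.conormal_s
  have := h.normal_e
  obtain ⟨-, -, -, -, he⟩ := h'
  obtain ⟨Y, e, hm⟩ := IsNormalForm.normal ((κe.proj h.idem_e).app S)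
  exact ⟨Y, e, (congrArg (incl G κe.closed).app hm).trans (he e)⟩

/-- Conormality of the projection identifies `κe (Im m)` with the image of `m` in the subform of
`κe`. Every cluster there is a kernel, also in `G` because the inclusion is normal. The top of that
subform supplies `t`. -/
theorem IsExactDecomposition.exists_app_im_eq_ker (h : IsExactDecomposition t G κs κe) {W X : C}
    (m : W ⟶ X) : ∃ (Y T : C) (b : X ⟶ Y) (t : W ⟶ T), ker G b = κe.app (im G m) ∧
      (∀ {V : C} (c : W ⟶ V), ker G c ≤ ker G t) ∧ ker G t ≤ ker G (m ≫ b) := by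
  obtain ⟨h, h'⟩ := h
  have := h.conormal_s
  have := h.normal_e
  obtain ⟨-, ⟨hc, -⟩, -, -, he⟩ := h'
  obtain ⟨Y, b, hb⟩ := IsNormalForm.normal (im κe.closedForm m)
  obtain ⟨T, t, ht⟩ := IsNormalForm.normal (⊤ : Cluster κe.closedForm W)
  refine ⟨Y, T, b, t, ?_, fun c => ?_, ?_⟩
  · rw [← he b, ← hb, ← hc m]
    rfl
  · rw [← he c, ← he t, ← ht]
    exact Operator.app_le_app _ le_top
  · rw [ker_comp, ← rel_iff_le_inv, ← he t, ← he b, ← ht, ← hb]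
    exact Operator.rel_app _ (dir_spec κe.closedForm m ⊤).1

/-- Dual argument: normality of the projection to the subform of `κs`, conormality of its inclusion,
and its bottom supplying `z`. -/
theorem IsExactDecomposition.exists_app_ker_eq_im (h : IsExactDecomposition t G κs κe) {X Y : C}
    (d : X ⟶ Y) : ∃ (W T : C) (n : W ⟶ X) (z : T ⟶ Y), im G n = κs.app (ker G d) ∧
      (∀ {V : C} (c : V ⟶ Y), im G z ≤ im G c) ∧ im G (n ≫ d) ≤ im G z := by
  obtain ⟨h, h'⟩ := h
  have := h.conormal_s
  have := h.normal_e
  obtain ⟨⟨-, hn⟩, -, -, hs, -⟩ := h'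
  obtain ⟨W, n, hb⟩ := IsConormalForm.conormal (ker κs.closedForm d)
  obtain ⟨T, z, hz⟩ := IsConormalForm.conormal (⊥ : Cluster κs.closedForm Y)
  refine ⟨W, T, n, z, ?_, fun c => ?_, ?_⟩
  · rw [← hs n, ← hb, ← hn d]
    rfl
  · rw [← hs c, ← hs z, ← hz]
    exact Operator.app_le_app _ bot_le
  · rw [im_comp, ← rel_iff_dir_le, ← hs z, ← hs n, ← hz, ← hb]
    exact Operator.rel_app _ (inv_spec κs.closedForm d ⊥).1

end Decompositions

/-! ### Optimality -/

section Optimality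

variable {𝔹 : Type u₁} [Category.{v₁} 𝔹] {𝔸 : Type u₂} [Category.{v₂} 𝔸]
  {C : Type u} [Category.{v} C] {F : 𝔹 ⥤ C} {G : 𝔸 ⥤ C} [IsNoetherian F] [IsNoetherian G]
  {κs κe : Operator G G}

theorem IsExactDecomposition.isIsomorphicToSubform_of_join
    (h : IsExactDecomposition .join G κs κe) (hE : quotients F = quotients G)
    (hM : embeddings F = embeddings G) : IsIsomorphicToSubform G F := by
  have hdec {X : C} (S : Cluster G X) : S = κs.app S ⊔ κe.app S := h.1.eq_eval S
  choose W m hm using @h.exists_eq_im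
  choose Y e he using @h.exists_eq_ker
  have hS {X : C} (S : Cluster G X) : S = im G (m S) ⊔ ker G (e S) := by
    rw [← hm, ← he]
    exact hdec S
  have hrel {X Y Z : C} {a : X ⟶ Z} {g : X ⟶ Y} {V : C} {l : V ⟶ Y}
      (hr : Rel F g (ker F a) (im F l)) : Rel G g (ker G a) (im G l) :=
    rel_ker_im_of_le hE.le hM.le (fun _ _ => ker_le_im_of_exists_ker_le_im hM fun n => by
      obtain ⟨Y, T, b, t, hb, ht⟩ := h.exists_app_im_eq_ker n
      refine ⟨Y, T, b, t, ?_, ht⟩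
      rw [hb]
      exact le_sup_right.trans (hdec _).ge) hr
  refine isIsomorphicToSubform_of_rel_iff (fun S => im F (m S) ⊔ ker F (e S)) fun f A B => ?_
  constructor
  · intro hAB
    -- The same rewriting in `F` and in `G` splits the relation into an inequality of images and a
    -- relation from a kernel to an image.
    rw [rel_iff_le_inv, sup_le_iff, ← rel_iff_le_inv, ← rel_iff_le_inv, im_sup_ker,
      ← rel_comp_iff_inv, ← rel_comp_iff_inv, rel_iff_dir_le, ← im_comp] at hAB
    rw [hS A, hS B, rel_iff_le_inv, sup_le_iff, ← rel_iff_le_inv, ← rel_iff_le_inv, im_sup_ker,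
      ← rel_comp_iff_inv, ← rel_comp_iff_inv, rel_iff_dir_le, ← im_comp]
    exact ⟨im_le_im_of_quotients_le hE.le hAB.1, hrel hAB.2⟩
  · intro hAB
    have h₁ := κs.rel_app hAB
    have h₂ := κe.rel_app hAB
    rw [hm, hm, rel_iff_dir_le, ← im_comp] at h₁
    rw [he, he, rel_iff_le_inv, ← ker_comp] at h₂
    replace h₁ := im_le_im_of_quotients_le hE.ge h₁
    replace h₂ := ker_le_ker_of_embeddings_le hM.ge h₂
    rw [im_comp, ← rel_iff_dir_le] at h₁
    rw [ker_comp, ← rel_iff_le_inv] at h₂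
    rw [rel_iff_le_inv, sup_le_iff, ← rel_iff_le_inv, ← rel_iff_le_inv]
    exact ⟨h₁.le_right le_sup_left, h₂.le_right le_sup_right⟩

theorem IsExactDecomposition.isIsomorphicToSubform_of_meet
    (h : IsExactDecomposition .meet G κs κe) (hE : quotients F = quotients G)
    (hM : embeddings F = embeddings G) : IsIsomorphicToSubform G F := by
  have hdec {X : C} (S : Cluster G X) : S = κs.app S ⊓ κe.app S := h.1.eq_eval S
  choose W m hm using @h.exists_eq_im
  choose Y e he using @h.exists_eq_ker
  have hS {X : C} (S : Cluster G X) : S = im G (m S) ⊓ ker G (e S) := by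
    rw [← hm, ← he]
    exact hdec S
  have hrel {X Y Z : C} {a : X ⟶ Z} {g : X ⟶ Y} {V : C} {l : V ⟶ Y}
      (hr : Rel F g (ker F a) (im F l)) : Rel G g (ker G a) (im G l) :=
    rel_ker_im_of_le hE.le hM.le (fun _ _ => ker_le_im_of_exists_ker_le_im' hE fun d => by
      obtain ⟨W, T, n, z, hn, hz⟩ := h.exists_app_ker_eq_im d
      refine ⟨W, T, n, z, ?_, hz⟩
      rw [hn]
      exact (hdec _).le.trans inf_le_left) hr
  refine isIsomorphicToSubform_of_rel_iff (fun S => im F (m S) ⊓ ker F (e S)) fun f A B => ?_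
  constructor
  · intro hAB
    -- Here the split gives an inequality of kernels and a relation from a kernel to an image;
    -- `and_comm` puts the former first so that the next rewrite hits it.
    rw [rel_iff_dir_le, le_inf_iff, ← rel_iff_dir_le, ← rel_iff_dir_le, im_inf_ker,
      ← rel_comp_iff_dir, ← rel_comp_iff_dir, and_comm, rel_iff_le_inv, ← ker_comp] at hAB
    rw [hS A, hS B, rel_iff_dir_le, le_inf_iff, ← rel_iff_dir_le, ← rel_iff_dir_le, im_inf_ker,
      ← rel_comp_iff_dir, ← rel_comp_iff_dir, and_comm, rel_iff_le_inv, ← ker_comp]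
    exact ⟨ker_le_ker_of_embeddings_le hM.le hAB.1, hrel hAB.2⟩
  · intro hAB
    have h₁ := κs.rel_app hAB
    have h₂ := κe.rel_app hAB
    rw [hm, hm, rel_iff_dir_le, ← im_comp] at h₁
    rw [he, he, rel_iff_le_inv, ← ker_comp] at h₂
    replace h₁ := im_le_im_of_quotients_le hE.ge h₁
    replace h₂ := ker_le_ker_of_embeddings_le hM.ge h₂
    rw [im_comp, ← rel_iff_dir_le] at h₁
    rw [ker_comp, ← rel_iff_le_inv] at h₂
    rw [rel_iff_dir_le, le_inf_iff, ← rel_iff_dir_le, ← rel_iff_dir_le]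
    exact ⟨h₁.le_left inf_le_left, h₂.le_left inf_le_right⟩

end Optimality

end Forms

end

theorem mainTheorem4 {C : Type u} [Category.{v} C] (E M : MorphismProperty C)
    {𝔸 : Type u₂} [Category.{v₂} 𝔸] (G : 𝔸 ⥤ C) (hG : Forms.IsNoetherianOver G E M) :
    (Forms.HasExactJoinDecomposition G → Forms.IsOptimal.{v₂, v₃, v, u₂, u₃, u} G E M) ∧
    (Forms.HasExactMeetDecomposition G → Forms.IsOptimal.{v₂, v₃, v, u₂, u₃, u} G E M) := by
  obtain ⟨hN, hE, hM⟩ := id hG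
  constructor
  · rintro ⟨_, κs, κe, h⟩
    refine ⟨hG, fun 𝔹 _ F ⟨hF, hE', hM'⟩ => ?_⟩
    exact h.isIsomorphicToSubform_of_join (hE'.symm.trans hE) (hM'.symm.trans hM)
  · rintro ⟨_, κs, κe, h⟩
    refine ⟨hG, fun 𝔹 _ F ⟨hF, hE', hM'⟩ => ?_⟩
    exact h.isIsomorphicToSubform_of_meet (hE'.symm.trans hE) (hM'.symm.trans hM)
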